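/- Let $\lambda,\mu>0$, $0<q<1$, $b\in\mathbb N$, and let $Y$ be a random variable with $P(Y=j)=p_j$ for $j=1,\dots,b$, $\sum_{j=1}^b p_j=1$; write $\phi_Y(x)=\sum_{j=1}^b p_jx^j$. The homogeneous $\mathrm{Cox}(\infty)/M^Y/1$ queue is the continuous-time Markov chain on $\{(m,i): m,i\in\{0,1,2,\dots\}\}$ ($m$ customers present, $i$ completed arrival phases of the next customer) with transition rates $\lambda q$ from $(m,i)$ to $(m,i+1)$, $\lambda(1-q)$ from $(m,i)$ to $(m+1,0)$, and, for $m\ge 1$ and $1\le j\le b$, $\mu p_j$ from $(m,i)$ to $(\max(m-j,0),i)$. Theorem. Suppose that $\lambda(1-q)<\mu\,E[Y]$ (in particular, suppose that $\lambda(1-q)/q<\mu\,E[Y]$). Then the equations $$\alpha=\frac{\lambda}{\lambda+\mu-\mu\phi_Y(\gamma)},\qquad \gamma=\frac{\alpha(1-q)}{1-q\alpha}$$ have exactly one solution $(\gamma,\alpha)$ with $0<\gamma<1$; the queue has exactly one stationary distribution $\pi$; and $\pi$ is given by $$\pi_{(m,i)}=\pi_{(0,0)}\,\frac{\lambda(1-\gamma)\gamma^{m-1}}{\mu(1-\phi_Y(\gamma))}\,(q\alpha)^i\qquad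 (m\ge 1,\ i\ge 0),$$ $$\pi_{(0,i)}=\pi_{(0,0)}\,q^i\Bigl(1+\sum_{j=1}^i\alpha^j\Bigr)\qquad (i\ge 1),\qquad \pi_{(0,0)}=(1-q)(1-\alpha).$$ -/

import Mathlib

noncomputable section

namespace CoxQueue

/-- State `(m, i)`: there are `m` customers in the system and the arrival process of the next
customer has completed `i` phases; `m` and `i` range over all natural numbers. -/
abbrev State : Type := ℕ × ℕ

/-- The probability generating function `φ_Y(x) = ∑_{j=1}^b p_j x^j` of the batch size `Y`. -/
def pgf (b : ℕ) (p : ℕ → ℝ) (x : ℝ) : ℝ := ∑ j ∈ Finset.Icc 1 b, p j * x ^ j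

/-- The mean batch size `E[Y] = ∑_{j=1}^b j p_j`. -/
def meanBatch (b : ℕ) (p : ℕ → ℝ) : ℝ := ∑ j ∈ Finset.Icc 1 b, (j : ℝ) * p j

/-- The infinitesimal generator, acting on functions. From `(m, i)` the process jumps to
`(m, i + 1)` at rate `lam * q` (a new phase starts), to `(m + 1, 0)` at rate `lam * (1 - q)`
(an arrival), and to `(max (m - j) 0, i)` at rate `mu * p j` for `1 ≤ j ≤ b` (a batch service).
The subtraction `m - j` is truncated, so that a batch larger than the number of customers present
empties the system, and for `m = 0` the service terms vanish. -/
def genFun (lam mu q : ℝ) (b : ℕ) (p : ℕ → ℝ) (f : State → ℝ) (x : State) : ℝ :=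
  lam * q * (f (x.1, x.2 + 1) - f x) + lam * (1 - q) * (f (x.1 + 1, 0) - f x)
    + ∑ j ∈ Finset.Icc 1 b, mu * p j * (f (x.1 - j, x.2) - f x)

/-- The transition probabilities `P_t(x, y)` of the queueing process, the continuous-time Markov
chain with the above generator `G`. The jump rates are bounded, so the transition function is the
exponential `P_t = exp (t G)`, that is `P_t(x, y) = ∑_n (t ^ n / n!) (G ^ n 1_y)(x)`. -/
def transProb (lam mu q : ℝ) (b : ℕ) (p : ℕ → ℝ) (t : ℝ) (x y : State) : ℝ :=
  ∑' n : ℕ, t ^ n / (n.factorial : ℝ) *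
    (genFun lam mu q b p)^[n] (fun z => if z = y then 1 else 0) x

/-- A bound for the operator norm of the generator on bounded functions (twice the total rate). -/
def genBound (lam mu q : ℝ) (b : ℕ) (p : ℕ → ℝ) : ℝ :=
  2 * |lam * q| + 2 * |lam * (1 - q)| + ∑ j ∈ Finset.Icc 1 b, 2 * |mu * p j|

theorem abs_genFun_le (lam mu q : ℝ) (b : ℕ) (p : ℕ → ℝ) (f : State → ℝ) (C : ℝ)
    (hf : ∀ x, |f x| ≤ C) (x : State) :
    |genFun lam mu q b p f x| ≤ genBound lam mu q b p * C := by
  have key : ∀ (c : ℝ) (y : State), |c * (f y - f x)| ≤ 2 * |c| * C := by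
    intro c y
    have h : |f y - f x| ≤ 2 * C := by
      have h3 := abs_sub (f y) (f x)
      linarith [hf x, hf y]
    rw [abs_mul]
    nlinarith [abs_nonneg c]
  unfold genFun genBound
  rw [add_mul, add_mul, Finset.sum_mul]
  refine (abs_add_le _ _).trans (add_le_add ((abs_add_le _ _).trans (add_le_add ?_ ?_)) ?_)
  · exact key _ _
  · exact key _ _
  · exact (Finset.abs_sum_le_sum_abs _ _).trans (Finset.sum_le_sum fun j _ => key _ _)

theorem abs_iterate_genFun_le (lam mu q : ℝ) (b : ℕ) (p : ℕ → ℝ) (y : State) (n : ℕ) :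
    ∀ x, |(genFun lam mu q b p)^[n] (fun z => if z = y then 1 else 0) x|
      ≤ genBound lam mu q b p ^ n := by
  induction n with
  | zero =>
    intro x
    simp only [Function.iterate_zero, id_eq, pow_zero]
    split_ifs <;> simp
  | succ n ih =>
    intro x
    rw [Function.iterate_succ_apply', pow_succ']
    exact abs_genFun_le lam mu q b p _ _ ih x

/-- The exponential series that defines the transition probabilities converges. -/
theorem summable_transProb (lam mu q : ℝ) (b : ℕ) (p : ℕ → ℝ) (t : ℝ) (x y : State) :
    Summable fun n : ℕ => t ^ n / (n.factorial : ℝ) *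
      (genFun lam mu q b p)^[n] (fun z => if z = y then 1 else 0) x := by
  refine Summable.of_norm_bounded
    (Real.summable_pow_div_factorial (|t| * genBound lam mu q b p)) fun n => ?_
  have h := abs_iterate_genFun_le lam mu q b p y n x
  rw [Real.norm_eq_abs, abs_mul, abs_div, abs_pow, Nat.abs_cast, mul_pow, mul_div_right_comm]
  exact mul_le_mul_of_nonneg_left h (by positivity)

/-- `π` is a stationary distribution of the `Cox(∞)/M^Y/1` queue with homogeneous phase rate `lam`,
continuation probability `q`, service rate `mu` and batch size probabilities `p 1, …, p b`:
a probability distribution with `π P_t = π` for all `t ≥ 0`. -/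
def IsStationary (lam mu q : ℝ) (b : ℕ) (p : ℕ → ℝ) (π : State → ℝ) : Prop :=
  (∀ x, 0 ≤ π x) ∧ HasSum π 1 ∧
    ∀ t : ℝ, 0 ≤ t → ∀ y, HasSum (fun x => π x * transProb lam mu q b p t x y) (π y)

/-- The equations `α = λ / (λ + μ - μ φ_Y(γ))` and `γ = α (1 - q) / (1 - q α)` with `0 < γ < 1`. -/
def IsFactorPair (lam mu q : ℝ) (b : ℕ) (p : ℕ → ℝ) (γ α : ℝ) : Prop :=
  0 < γ ∧ γ < 1 ∧ α = lam / (lam + mu - mu * pgf b p γ) ∧ γ = α * (1 - q) / (1 - q * α)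

end CoxQueue

end

/-! There are finitely many moves, at constant rates, so stationarity under `exp (t G)` is
equivalent to the balance equations: `π` pairs to zero with `G 1_y` for every `y`. Given balance,
`π` annihilates `G f` for all bounded `f`, so only the term `n = 0` of the exponential series
survives (`hasSum_mul_jumpTrans_of_jumpPairing`). Conversely, the coefficient of `t` is isolated by
letting `t → 0` (`jumpPairing_eq_zero_of_stationary`).

Uniqueness: the difference `u` of two stationary distributions is balanced and has mass zero. Then
`|u|` is balanced, and `|u| + u` and `|u| - u` are nonnegative with supports closed under the moves.
If both were nonzero, both would be positive at the empty state, which is impossible. So `u` has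
constant sign and vanishes (`eq_zero_of_jumpPairing_eq_zero`).

Existence: with `S(x) = (1 - φ_Y(x)) / (1 - x)`, eliminating `α` and cancelling `1 - γ` leaves `μ γ
S(γ) = λ (1 - q)`. On `[0, 1]` the function `x S(x)` increases strictly from `0` to `E[Y]`, so there
is exactly one root. This relation and `α (1 - q + q γ) = γ` turn balance for `productForm` into
algebra. -/

noncomputable section

namespace CoxQueue

open Filter Topology

/-! ### Chains with finitely many deterministic moves at constant rates -/

section JumpChain

variable {X ι : Type*} (s : Finset ι) (r : ι → ℝ) (τ : ι → X → X)

/-- The generator of the chain that makes the move `τ k` at rate `r k`, for `k ∈ s`. -/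
def jumpGen (f : X → ℝ) (x : X) : ℝ := ∑ k ∈ s, r k * (f (τ k x) - f x)

/-- A bound for the operator norm of `jumpGen`. -/
def jumpBound : ℝ := ∑ k ∈ s, 2 * |r k|

theorem jumpBound_nonneg : 0 ≤ jumpBound s r :=
  Finset.sum_nonneg fun _ _ => by positivity

theorem abs_jumpGen_le {f : X → ℝ} {C : ℝ} (hf : ∀ x, |f x| ≤ C) (x : X) :
    |jumpGen s r τ f x| ≤ jumpBound s r * C := by
  unfold jumpGen jumpBound
  rw [Finset.sum_mul]
  refine (Finset.abs_sum_le_sum_abs _ _).trans (Finset.sum_le_sum fun k _ => ?_)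
  have h : |f (τ k x) - f x| ≤ 2 * C := by
    have h3 := abs_sub (f (τ k x)) (f x)
    linarith [hf x, hf (τ k x)]
  rw [abs_mul]
  nlinarith [abs_nonneg (r k)]

theorem jumpGen_sum (S : Finset X) (f : X → ℝ) (g : X → X → ℝ) (x : X) :
    jumpGen s r τ (fun z => ∑ y ∈ S, f y * g y z) x
      = ∑ y ∈ S, f y * jumpGen s r τ (g y) x := by
  simp only [jumpGen, ← Finset.sum_sub_distrib, Finset.mul_sum]
  rw [Finset.sum_comm]
  exact Finset.sum_congr rfl fun _ _ => Finset.sum_congr rfl fun _ _ => by ring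

theorem summable_mul_of_abs_le {u f : X → ℝ} {C : ℝ} (hu : Summable u)
    (hf : ∀ x, |f x| ≤ C) : Summable fun x => u x * f x := by
  refine Summable.of_norm_bounded (hu.abs.mul_right C) fun x => ?_
  rw [Real.norm_eq_abs, abs_mul]
  exact mul_le_mul_of_nonneg_left (hf x) (abs_nonneg _)

variable [DecidableEq X]

/-- The indicator function of the point `y`. -/
def pointInd (y : X) : X → ℝ := fun z => if z = y then 1 else 0

/-- The value of the signed measure `u` on the image of `f` under the generator. -/
def jumpPairing (u f : X → ℝ) : ℝ := ∑' x, u x * jumpGen s r τ f x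

theorem abs_pointInd_le (y x : X) : |pointInd y x| ≤ 1 := by
  unfold pointInd; split_ifs <;> simp

theorem abs_iterate_jumpGen_le (y : X) (n : ℕ) :
    ∀ x, |(jumpGen s r τ)^[n] (pointInd y) x| ≤ jumpBound s r ^ n := by
  induction n with
  | zero => intro x; simpa using abs_pointInd_le y x
  | succ n ih =>
    intro x
    rw [Function.iterate_succ_apply', pow_succ']
    exact abs_jumpGen_le s r τ ih x

theorem sum_mul_pointInd (S : Finset X) (f : X → ℝ) (z : X) :
    ∑ y ∈ S, f y * pointInd y z = if z ∈ S then f z else 0 := by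
  simp [pointInd]

/-- For a bounded function the pairing is the sum of the pairings with the points. -/
theorem hasSum_jumpPairing {u f : X → ℝ} {C : ℝ} (hu : Summable u) (hf : ∀ x, |f x| ≤ C) :
    HasSum (fun y => f y * jumpPairing s r τ u (pointInd y)) (jumpPairing s r τ u f) := by
  classical
  have hsum : ∀ S : Finset X, ∑ y ∈ S, f y * jumpPairing s r τ u (pointInd y)
      = ∑' x, u x * jumpGen s r τ (fun z => if z ∈ S then f z else 0) x := by
    intro S
    simp only [← sum_mul_pointInd, jumpGen_sum, jumpPairing, Finset.mul_sum, ← tsum_mul_left]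
    rw [Summable.tsum_finsetSum]
    · exact Finset.sum_congr rfl fun _ _ => tsum_congr fun _ => by ring
    · intro y _
      have := (summable_mul_of_abs_le hu
        (abs_jumpGen_le s r τ (abs_pointInd_le y))).mul_left (f y)
      exact this.congr fun x => by ring
  unfold HasSum
  simp only [hsum, SummationFilter.unconditional_filter]
  refine tendsto_tsum_of_dominated_convergence (bound := fun x => |u x| * (jumpBound s r * C))
    (hu.abs.mul_right _) (fun x => ?_) (Eventually.of_forall fun S x => ?_)
  -- The generator at `x` sees only `x` and its finitely many images, so cutting `f` off outside a
  -- large enough `S` changes nothing there.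
  · refine tendsto_const_nhds.congr' ?_
    filter_upwards [eventually_ge_atTop (insert x (s.image fun k => τ k x))] with S hS
    have hx : x ∈ S := hS (Finset.mem_insert_self _ _)
    have hk : ∀ k ∈ s, τ k x ∈ S := fun k hk =>
      hS (Finset.mem_insert_of_mem (Finset.mem_image_of_mem _ hk))
    unfold jumpGen
    congr 1
    exact Finset.sum_congr rfl fun k hks => by
      simp only [if_pos hx, if_pos (hk k hks)]
  · rw [Real.norm_eq_abs, abs_mul]
    refine mul_le_mul_of_nonneg_left (abs_jumpGen_le s r τ (fun z => ?_) x) (abs_nonneg _)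
    split_ifs
    · exact hf z
    · simpa using (abs_nonneg _).trans (hf z)

theorem jumpPairing_eq_zero {u f : X → ℝ} {C : ℝ} (hu : Summable u) (hf : ∀ x, |f x| ≤ C)
    (h : ∀ y, jumpPairing s r τ u (pointInd y) = 0) : jumpPairing s r τ u f = 0 := by
  have := hasSum_jumpPairing s r τ hu hf
  simp only [h, mul_zero] at this
  exact this.unique hasSum_zero

/-- Conservation of mass: the generator kills constants. -/
theorem hasSum_jumpPairing_pointInd {u : X → ℝ} (hu : Summable u) :
    HasSum (fun y => jumpPairing s r τ u (pointInd y)) 0 := by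
  have h := hasSum_jumpPairing s r τ (f := fun _ => 1) (C := 1) hu (by simp)
  simpa [jumpPairing, jumpGen] using h

/-! ### The exponential series and stationarity -/

/-- The transition function `exp (t G)` of the chain. -/
def jumpTrans (t : ℝ) (x y : X) : ℝ :=
  ∑' n : ℕ, t ^ n / (n.factorial : ℝ) * (jumpGen s r τ)^[n] (pointInd y) x

theorem summable_jumpTrans_uncurry {u : X → ℝ} (hu : Summable u) (t : ℝ) (y : X) :
    Summable fun z : X × ℕ =>
      u z.1 * (t ^ z.2 / (z.2.factorial : ℝ) * (jumpGen s r τ)^[z.2] (pointInd y) z.1) := by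
  have h := hu.abs.mul_of_nonneg
    (Real.summable_pow_div_factorial (|t| * jumpBound s r)) (fun _ => abs_nonneg _)
    (fun n => by
      have := jumpBound_nonneg s r
      positivity)
  refine Summable.of_norm_bounded h fun z => ?_
  rw [Real.norm_eq_abs, abs_mul, abs_mul, abs_div, abs_pow, Nat.abs_cast, mul_pow,
    mul_div_right_comm]
  have := abs_iterate_jumpGen_le s r τ y z.2 z.1
  gcongr

theorem tsum_mul_jumpTrans {u : X → ℝ} (hu : Summable u) (t : ℝ) (y : X) :
    ∑' x, u x * jumpTrans s r τ t x y = ∑' n : ℕ, t ^ n / (n.factorial : ℝ) *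
      ∑' x, u x * (jumpGen s r τ)^[n] (pointInd y) x := by
  simp only [jumpTrans, ← tsum_mul_left]
  rw [Summable.tsum_comm (summable_jumpTrans_uncurry s r τ hu t y).prod_symm]
  exact tsum_congr fun n => tsum_congr fun x => by ring

theorem summable_mul_jumpTrans {u : X → ℝ} (hu : Summable u) (t : ℝ) (y : X) :
    Summable fun x => u x * jumpTrans s r τ t x y := by
  have := (summable_jumpTrans_uncurry s r τ hu t y).prod
  simpa only [jumpTrans, tsum_mul_left] using this

theorem tsum_mul_pointInd (u : X → ℝ) (y : X) : ∑' x, u x * pointInd y x = u y := by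
  rw [tsum_eq_single y] <;> simp +contextual [pointInd]

theorem hasSum_mul_jumpTrans_of_jumpPairing {u : X → ℝ} (hu : Summable u)
    (h : ∀ y, jumpPairing s r τ u (pointInd y) = 0) (t : ℝ) (y : X) :
    HasSum (fun x => u x * jumpTrans s r τ t x y) (u y) := by
  refine (summable_mul_jumpTrans s r τ hu t y).hasSum_iff.2 ?_
  rw [tsum_mul_jumpTrans s r τ hu, tsum_eq_single 0]
  · simp [tsum_mul_pointInd]
  · intro n hn
    obtain ⟨m, rfl⟩ := Nat.exists_eq_succ_of_ne_zero hn
    simp only [Function.iterate_succ_apply']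
    -- Balance at points extends to the bounded function `G ^ m 1_y`.
    have := jumpPairing_eq_zero s r τ hu (abs_iterate_jumpGen_le s r τ y m) h
    rw [jumpPairing] at this
    rw [this, mul_zero]

/-- A power series that vanishes on `(0, 1]` has vanishing constant coefficient. -/
theorem constCoeff_eq_zero_of_tsum_eq_zero {c : ℕ → ℝ} (hc : Summable c)
    (h : ∀ t : ℝ, 0 < t → t ≤ 1 → ∑' n, t ^ n * c n = 0) : c 0 = 0 := by
  have hlim : Tendsto (fun t : ℝ => ∑' n, t ^ n * c n) (𝓝[>] 0) (𝓝 (∑' n, (0 : ℝ) ^ n * c n)) := by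
    refine tendsto_tsum_of_dominated_convergence (bound := fun n => |c n|) hc.abs (fun n => ?_) ?_
    · exact ((continuous_pow n).tendsto (0 : ℝ) |>.mono_left nhdsWithin_le_nhds).mul_const _
    · filter_upwards [Ioc_mem_nhdsGT (zero_lt_one (α := ℝ))] with t ht n
      rw [Real.norm_eq_abs, abs_mul, abs_of_nonneg (pow_nonneg ht.1.le n)]
      exact mul_le_of_le_one_left (abs_nonneg _) (pow_le_one₀ ht.1.le ht.2)
  have h0 : Tendsto (fun t : ℝ => ∑' n, t ^ n * c n) (𝓝[>] 0) (𝓝 0) := by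
    refine tendsto_const_nhds.congr' ?_
    filter_upwards [Ioc_mem_nhdsGT (zero_lt_one (α := ℝ))] with t ht
    exact (h t ht.1 ht.2).symm
  have := tendsto_nhds_unique hlim h0
  rw [tsum_eq_single 0 (fun n hn => by simp [hn])] at this
  simpa using this

/-- Stationarity makes the terms `n ≥ 1` of the series in `t` sum to zero; after division by `t` the
constant coefficient is the pairing. -/
theorem jumpPairing_eq_zero_of_stationary {u : X → ℝ} (hu : Summable u) (y : X)
    (h : ∀ t : ℝ, 0 ≤ t → HasSum (fun x => u x * jumpTrans s r τ t x y) (u y)) :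
    jumpPairing s r τ u (pointInd y) = 0 := by
  set a : ℕ → ℝ := fun n => ∑' x, u x * (jumpGen s r τ)^[n] (pointInd y) x with ha
  have hB := jumpBound_nonneg s r
  have habs : ∀ n, |a n| ≤ (∑' x, |u x|) * jumpBound s r ^ n := by
    intro n
    rw [ha, ← tsum_mul_right, ← Real.norm_eq_abs]
    refine tsum_of_norm_bounded (hu.abs.mul_right _).hasSum fun x => ?_
    rw [Real.norm_eq_abs, abs_mul]
    exact mul_le_mul_of_nonneg_left (abs_iterate_jumpGen_le s r τ y n x) (abs_nonneg _)
  have hsum : ∀ t : ℝ, Summable fun n : ℕ => t ^ n / (n.factorial : ℝ) * a n := by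
    intro t
    refine Summable.of_norm_bounded
      ((Real.summable_pow_div_factorial (|t| * jumpBound s r)).mul_left (∑' x, |u x|)) fun n => ?_
    rw [Real.norm_eq_abs, abs_mul, abs_div, abs_pow, Nat.abs_cast, mul_pow, mul_div_right_comm,
      mul_left_comm]
    exact mul_le_mul_of_nonneg_left (habs n) (by positivity)
  have ha0 : a 0 = u y := by simp [ha, tsum_mul_pointInd]
  have ha1 : jumpPairing s r τ u (pointInd y) = a 1 := by simp [ha, jumpPairing]
  rw [ha1]
  have := constCoeff_eq_zero_of_tsum_eq_zero
    (c := fun n => a (n + 1) / ((n + 1).factorial : ℝ)) ?_ ?_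
  · simpa using this
  · refine ((summable_nat_add_iff 1).2 (hsum 1)).congr fun n => ?_
    rw [one_pow]; ring
  · intro t ht _
    have h1 := (h t ht.le).tsum_eq
    rw [tsum_mul_jumpTrans s r τ hu, (hsum t).tsum_eq_zero_add] at h1
    have h2 : ∑' n : ℕ, t ^ (n + 1) / ((n + 1).factorial : ℝ) * a (n + 1) = 0 := by
      simp only [pow_zero, Nat.factorial_zero, Nat.cast_one, div_one, one_mul, ha0] at h1
      linarith
    have h3 : t * ∑' n : ℕ, t ^ n * (a (n + 1) / ((n + 1).factorial : ℝ)) = 0 := by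
      rw [← h2, ← tsum_mul_left]
      exact tsum_congr fun n => by ring
    exact (mul_eq_zero.1 h3).resolve_left ht.ne'

/-! ### Uniqueness of the stationary distribution -/

/-- Splitting off the diagonal part of the pairing with a point. -/
theorem hasSum_mul_moves {u : X → ℝ} (hu : Summable u) (y : X) :
    HasSum (fun x => u x * ∑ k ∈ s, r k * pointInd y (τ k x))
      (jumpPairing s r τ u (pointInd y) + (∑ k ∈ s, r k) * u y) := by
  have h1 := (summable_mul_of_abs_le hu (abs_jumpGen_le s r τ (abs_pointInd_le y))).hasSum
  have h2 := (summable_mul_of_abs_le hu (abs_pointInd_le y)).hasSum.mul_left (∑ k ∈ s, r k)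
  rw [tsum_mul_pointInd] at h2
  refine (h1.add h2).congr_fun fun x => ?_
  simp only [jumpGen, mul_sub, Finset.sum_sub_distrib, ← Finset.sum_mul]
  ring

/-- The triangle inequality for the inflow into `y` makes every pairing of `|u|` nonnegative; by
conservation of mass they sum to zero, so each vanishes. -/
theorem jumpPairing_abs_eq_zero {u : X → ℝ} (hr : ∀ k ∈ s, 0 ≤ r k) (hu : Summable u)
    (h : ∀ y, jumpPairing s r τ u (pointInd y) = 0) (y : X) :
    jumpPairing s r τ (fun x => |u x|) (pointInd y) = 0 := by
  have hnn : ∀ y, 0 ≤ jumpPairing s r τ (fun x => |u x|) (pointInd y) := by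
    intro y
    have h1 := hasSum_mul_moves s r τ hu y
    have h2 := hasSum_mul_moves s r τ hu.abs y
    rw [h, zero_add] at h1
    have h0 : ∀ x, 0 ≤ ∑ k ∈ s, r k * pointInd y (τ k x) := fun x =>
      Finset.sum_nonneg fun k hk => mul_nonneg (hr k hk) (by unfold pointInd; split_ifs <;> simp)
    have h3 : |(∑ k ∈ s, r k) * u y| ≤
        jumpPairing s r τ (fun x => |u x|) (pointInd y) + (∑ k ∈ s, r k) * |u y| := by
      rw [← h1.tsum_eq, ← Real.norm_eq_abs]
      exact tsum_of_norm_bounded h2 fun x => by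
        rw [Real.norm_eq_abs, abs_mul, abs_of_nonneg (h0 x)]
    rw [abs_mul, abs_of_nonneg (Finset.sum_nonneg hr)] at h3
    linarith
  exact congrFun ((hasSum_zero_iff_of_nonneg hnn).1
    (hasSum_jumpPairing_pointInd s r τ hu.abs)) y

/-- The support of a nonnegative invariant measure is closed under the moves. -/
theorem pos_of_move {v : X → ℝ} (hr : ∀ k ∈ s, 0 ≤ r k) (hv : Summable v) (hv0 : ∀ x, 0 ≤ v x)
    (h : ∀ y, jumpPairing s r τ v (pointInd y) = 0) {k : ι} (hk : k ∈ s) (hrk : 0 < r k) {x : X}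
    (hx : 0 < v x) : 0 < v (τ k x) := by
  have h1 := hasSum_mul_moves s r τ hv (τ k x)
  rw [h, zero_add] at h1
  have h0 : ∀ z, ∀ l ∈ s, 0 ≤ r l * pointInd (τ k x) (τ l z) := fun z l hl =>
    mul_nonneg (hr l hl) (by unfold pointInd; split_ifs <;> simp)
  have h2 : v x * ∑ l ∈ s, r l * pointInd (τ k x) (τ l x) ≤ (∑ l ∈ s, r l) * v (τ k x) :=
    le_hasSum h1 x fun z _ => mul_nonneg (hv0 z) (Finset.sum_nonneg (h0 z))
  have h3 : r k ≤ ∑ l ∈ s, r l * pointInd (τ k x) (τ l x) := by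
    refine le_trans ?_ (Finset.single_le_sum (h0 x) hk)
    simp [pointInd]
  have h4 : 0 < (∑ l ∈ s, r l) * v (τ k x) :=
    (mul_pos hx (hrk.trans_le h3)).trans_le h2
  exact pos_of_mul_pos_right h4 (Finset.sum_nonneg hr)

theorem jumpPairing_add_mul {u v : X → ℝ} (hu : Summable u) (hv : Summable v) (c : ℝ) (y : X) :
    jumpPairing s r τ (fun x => u x + c * v x) (pointInd y)
      = jumpPairing s r τ u (pointInd y) + c * jumpPairing s r τ v (pointInd y) := by
  have h1 := summable_mul_of_abs_le hu (abs_jumpGen_le s r τ (abs_pointInd_le y))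
  have h2 := summable_mul_of_abs_le hv (abs_jumpGen_le s r τ (abs_pointInd_le y))
  simp only [jumpPairing]
  rw [← tsum_mul_left, ← h1.tsum_add (h2.mul_left c)]
  exact tsum_congr fun x => by ring

/-- If some state `o` can be reached from every state, then a summable invariant signed measure
of total mass zero vanishes. -/
theorem eq_zero_of_jumpPairing_eq_zero {u : X → ℝ} (hr : ∀ k ∈ s, 0 ≤ r k) (o : X)
    (ho : ∀ P : X → Prop, (∀ x, P x → ∀ k ∈ s, 0 < r k → P (τ k x)) → ∀ x, P x → P o)
    (hu : HasSum u 0) (h : ∀ y, jumpPairing s r τ u (pointInd y) = 0) : u = 0 := by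
  have habs := jumpPairing_abs_eq_zero s r τ hr hu.summable h
  have key : ∀ c : ℝ, |c| = 1 → (∃ x, 0 < |u x| + c * u x) → 0 < |u o| + c * u o := by
    rintro c hc ⟨x, hx⟩
    refine ho (fun x => 0 < |u x| + c * u x) (fun x hx k hk hrk => ?_) x hx
    refine pos_of_move s r τ (v := fun x => |u x| + c * u x) hr
      (hu.summable.abs.add (hu.summable.mul_left c)) (fun x => ?_) (fun y => ?_) hk hrk hx
    · have := neg_abs_le (c * u x)
      rw [abs_mul, hc, one_mul] at this
      linarith
    · rw [jumpPairing_add_mul s r τ hu.summable.abs hu.summable, habs, h, mul_zero, add_zero]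
  -- Values of both signs would make `u o` both negative and positive.
  have hdich : (∀ x, 0 ≤ u x) ∨ ∀ x, 0 ≤ -u x := by
    by_contra hcon
    push Not at hcon
    obtain ⟨⟨x, hx⟩, z, hz⟩ := hcon
    have h1 := key (-1) (by simp) ⟨x, by linarith [abs_nonneg (u x)]⟩
    have h2 := key 1 (by simp) ⟨z, by linarith [abs_nonneg (u z)]⟩
    rcases abs_cases (u o) with hh | hh <;> linarith
  rcases hdich with hd | hd
  · exact (hasSum_zero_iff_of_nonneg hd).1 hu
  · have := (hasSum_zero_iff_of_nonneg hd).1 (by simpa using hu.neg)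
    funext x
    simpa using congrFun this x

end JumpChain

/-! ### The factor pair -/

/-- The polynomial `(1 - φ_Y(x)) / (1 - x)`. -/
def pgfQuot (b : ℕ) (p : ℕ → ℝ) (x : ℝ) : ℝ :=
  ∑ j ∈ Finset.Icc 1 b, p j * ∑ k ∈ Finset.range j, x ^ k

section FactorPair

variable {lam mu q : ℝ} {b : ℕ} {p : ℕ → ℝ}

theorem one_sub_mul_pgfQuot (hp1 : ∑ j ∈ Finset.Icc 1 b, p j = 1) (x : ℝ) :
    (1 - x) * pgfQuot b p x = 1 - pgf b p x := by
  have h : ∑ j ∈ Finset.Icc 1 b, (p j - p j * x ^ j) = 1 - pgf b p x := by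
    rw [Finset.sum_sub_distrib, hp1, pgf]
  rw [pgfQuot, ← h, Finset.mul_sum]
  refine Finset.sum_congr rfl fun j _ => ?_
  rw [mul_left_comm, mul_neg_geom_sum]
  ring

theorem pgfQuot_one : pgfQuot b p 1 = meanBatch b p := by
  simp [pgfQuot, meanBatch, mul_comm]

theorem continuous_pgfQuot : Continuous (pgfQuot b p) := by
  unfold pgfQuot; fun_prop

theorem pgfQuot_mono (hp : ∀ j ∈ Finset.Icc 1 b, 0 ≤ p j) {x y : ℝ} (hx : 0 ≤ x) (hxy : x ≤ y) :
    pgfQuot b p x ≤ pgfQuot b p y :=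
  Finset.sum_le_sum fun j hj => mul_le_mul_of_nonneg_left
    (Finset.sum_le_sum fun _ _ => pow_le_pow_left₀ hx hxy _) (hp j hj)

theorem pgfQuot_pos (hp : ∀ j ∈ Finset.Icc 1 b, 0 ≤ p j) (hp1 : ∑ j ∈ Finset.Icc 1 b, p j = 1)
    {x : ℝ} (hx : 0 ≤ x) : 0 < pgfQuot b p x := by
  refine lt_of_lt_of_le one_pos ((hp1.symm.le).trans (Finset.sum_le_sum fun j hj => ?_))
  refine le_mul_of_one_le_right (hp j hj) ?_
  have h0 : 0 ∈ Finset.range j := Finset.mem_range.2 (Finset.mem_Icc.1 hj).1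
  simpa using Finset.single_le_sum (f := fun k => x ^ k) (fun k _ => pow_nonneg hx k) h0

theorem mul_pgfQuot_strictMono (hp : ∀ j ∈ Finset.Icc 1 b, 0 ≤ p j)
    (hp1 : ∑ j ∈ Finset.Icc 1 b, p j = 1) {x y : ℝ} (hx : 0 ≤ x) (hxy : x < y) :
    x * pgfQuot b p x < y * pgfQuot b p y :=
  mul_lt_mul hxy (pgfQuot_mono hp hx hxy.le) (pgfQuot_pos hp hp1 hx) (hx.trans hxy.le)

/-- Clearing denominators and eliminating `α` leaves the spurious factor `1 - γ`, which is
cancelled; the last equation involves `γ` alone. -/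
theorem isFactorPair_iff (hlam : 0 < lam) (hmu : 0 < mu) (hq0 : 0 < q) (hq1 : q < 1)
    (hp : ∀ j ∈ Finset.Icc 1 b, 0 ≤ p j) (hp1 : ∑ j ∈ Finset.Icc 1 b, p j = 1) (γ α : ℝ) :
    IsFactorPair lam mu q b p γ α ↔ 0 < γ ∧ γ < 1 ∧ α * (1 - q + q * γ) = γ ∧
      mu * (γ * pgfQuot b p γ) = lam * (1 - q) := by
  have hS := one_sub_mul_pgfQuot hp1 γ
  constructor
  · rintro ⟨h0, h1, hα, hγ⟩
    -- Division by zero gives `0`, so a vanishing denominator would contradict `γ ≠ 0`.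
    have hne : 1 - q * α ≠ 0 := by
      intro h; rw [h, div_zero] at hγ; exact h0.ne' hγ
    have hα0 : α ≠ 0 := by
      intro h; rw [h, zero_mul, zero_div] at hγ; exact h0.ne' hγ
    have hD : lam + mu - mu * pgf b p γ ≠ 0 := by
      intro h; rw [h, div_zero] at hα; exact hα0 hα
    rw [eq_div_iff hne] at hγ
    rw [eq_div_iff hD] at hα
    have h2 : α * (1 - q + q * γ) = γ := by linear_combination -hγ
    refine ⟨h0, h1, h2, ?_⟩
    have h3 : (1 - γ) * (mu * (γ * pgfQuot b p γ) - lam * (1 - q)) = 0 := by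
      linear_combination (1 - q + q * γ) * hα - (lam + mu - mu * pgf b p γ) * h2 + mu * γ * hS
    exact sub_eq_zero.1 ((mul_eq_zero.1 h3).resolve_left (sub_pos.2 h1).ne')
  · rintro ⟨h0, h1, h2, h3⟩
    have hE : 0 < 1 - q + q * γ := by nlinarith
    have hSpos := pgfQuot_pos hp hp1 h0.le
    have hD : 0 < lam + mu - mu * pgf b p γ := by
      have : 0 < mu * ((1 - γ) * pgfQuot b p γ) := mul_pos hmu (mul_pos (sub_pos.2 h1) hSpos)
      rw [hS] at this
      linarith
    have hne : 1 - q * α ≠ 0 := by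
      intro h
      have h4 : α * (1 - q) = 0 := by linear_combination h2 + γ * h
      have h5 : α = 0 := (mul_eq_zero.1 h4).resolve_right (sub_pos.2 hq1).ne'
      rw [h5] at h
      simp at h
    refine ⟨h0, h1, ?_, ?_⟩
    · rw [eq_div_iff hD.ne']
      refine mul_right_cancel₀ hE.ne' ?_
      linear_combination (lam + mu - mu * pgf b p γ) * h2 - mu * γ * hS + (1 - γ) * h3
    · rw [eq_div_iff hne]
      linear_combination -h2

theorem exists_isFactorPair (hlam : 0 < lam) (hmu : 0 < mu) (hq0 : 0 < q) (hq1 : q < 1)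
    (hp : ∀ j ∈ Finset.Icc 1 b, 0 ≤ p j) (hp1 : ∑ j ∈ Finset.Icc 1 b, p j = 1)
    (herg : lam * (1 - q) < mu * meanBatch b p) :
    ∃ γ α : ℝ, IsFactorPair lam mu q b p γ α := by
  have hcont : ContinuousOn (fun x => mu * (x * pgfQuot b p x)) (Set.Icc 0 1) :=
    (continuous_const.mul (continuous_id.mul continuous_pgfQuot)).continuousOn
  have hmem : lam * (1 - q) ∈
      Set.Ioo (mu * (0 * pgfQuot b p 0)) (mu * (1 * pgfQuot b p 1)) := by
    rw [pgfQuot_one, zero_mul, mul_zero, one_mul]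
    exact ⟨mul_pos hlam (sub_pos.2 hq1), herg⟩
  obtain ⟨γ, ⟨h0, h1⟩, hγ⟩ := intermediate_value_Ioo zero_le_one hcont hmem
  have hE : 0 < 1 - q + q * γ := by nlinarith
  exact ⟨γ, γ / (1 - q + q * γ), (isFactorPair_iff hlam hmu hq0 hq1 hp hp1 _ _).2
    ⟨h0, h1, div_mul_cancel₀ _ hE.ne', hγ⟩⟩

theorem IsFactorPair.unique (hlam : 0 < lam) (hmu : 0 < mu) (hq0 : 0 < q) (hq1 : q < 1)
    (hp : ∀ j ∈ Finset.Icc 1 b, 0 ≤ p j) (hp1 : ∑ j ∈ Finset.Icc 1 b, p j = 1) {γ α γ' α' : ℝ}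
    (h : IsFactorPair lam mu q b p γ α) (h' : IsFactorPair lam mu q b p γ' α') :
    γ' = γ ∧ α' = α := by
  rw [isFactorPair_iff hlam hmu hq0 hq1 hp hp1] at h h'
  obtain ⟨h0, h1, h2, h3⟩ := h
  obtain ⟨h0', h1', h2', h3'⟩ := h'
  have hSS := mul_left_cancel₀ hmu.ne' (h3'.trans h3.symm)
  have hγ : γ' = γ := by
    rcases lt_trichotomy γ' γ with hl | hl | hl
    · exact absurd hSS (mul_pgfQuot_strictMono hp hp1 h0'.le hl).ne
    · exact hl
    · exact absurd hSS (mul_pgfQuot_strictMono hp hp1 h0.le hl).ne'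
  subst hγ
  have hE : 0 < 1 - q + q * γ' := by nlinarith
  exact ⟨rfl, mul_right_cancel₀ hE.ne' (h2'.trans h2.symm)⟩

end FactorPair

/-! ### The queue as a jump chain -/

/-- The moves of the queue: a new phase, an arrival, and the services of `j` customers. -/
def queueMoves (b : ℕ) : Finset (Bool ⊕ ℕ) := Finset.univ.disjSum (Finset.Icc 1 b)

/-- The rates of the moves. -/
def queueRate (lam mu q : ℝ) (p : ℕ → ℝ) : Bool ⊕ ℕ → ℝ
  | .inl true => lam * q
  | .inl false => lam * (1 - q)
  | .inr j => mu * p j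

/-- The effect of the moves. -/
def queueMap : Bool ⊕ ℕ → State → State
  | .inl true => fun x => (x.1, x.2 + 1)
  | .inl false => fun x => (x.1 + 1, 0)
  | .inr j => fun x => (x.1 - j, x.2)

section Queue

variable (lam mu q : ℝ) (b : ℕ) (p : ℕ → ℝ)

theorem sum_queueMoves (F : Bool ⊕ ℕ → ℝ) :
    ∑ k ∈ queueMoves b, F k
      = F (.inl true) + F (.inl false) + ∑ j ∈ Finset.Icc 1 b, F (.inr j) := by
  simp [queueMoves, Finset.sum_disjSum]

theorem genFun_eq_jumpGen :
    genFun lam mu q b p = jumpGen (queueMoves b) (queueRate lam mu q p) queueMap := by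
  funext f x
  rw [jumpGen, sum_queueMoves]
  rfl

theorem transProb_eq_jumpTrans :
    transProb lam mu q b p = jumpTrans (queueMoves b) (queueRate lam mu q p) queueMap := by
  funext t x y
  unfold transProb jumpTrans
  rw [genFun_eq_jumpGen]
  rfl

variable {lam mu q b p}

theorem queueRate_nonneg (hlam : 0 < lam) (hmu : 0 < mu) (hq0 : 0 < q) (hq1 : q < 1)
    (hp : ∀ j ∈ Finset.Icc 1 b, 0 ≤ p j) :
    ∀ k ∈ queueMoves b, 0 ≤ queueRate lam mu q p k := by
  rintro ((_ | _) | j) hk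
  · exact mul_nonneg hlam.le (sub_pos.2 hq1).le
  · exact mul_nonneg hlam.le hq0.le
  · exact mul_nonneg hmu.le (hp j (by simpa [queueMoves] using hk))

/-- The empty state is reached from every state. -/
theorem queue_reach (hlam : 0 < lam) (hmu : 0 < mu) (hq1 : q < 1)
    (hp1 : ∑ j ∈ Finset.Icc 1 b, p j = 1)
    (P : State → Prop)
    (hP : ∀ x, P x → ∀ k ∈ queueMoves b, 0 < queueRate lam mu q p k → P (queueMap k x))
    (x : State) (hx : P x) : P (0, 0) := by
  obtain ⟨j, hj, hpj⟩ : ∃ j ∈ Finset.Icc 1 b, 0 < p j := by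
    by_contra! hcon
    linarith [Finset.sum_nonpos hcon]
  have hj1 := (Finset.mem_Icc.1 hj).1
  have hserve : ∀ m i, P (m, i) → P (m - j, i) := fun m i h =>
    hP _ h (.inr j) (by simpa [queueMoves] using hj) (mul_pos hmu hpj)
  have hempty : ∀ m i, P (m, i) → P (0, i) := by
    intro m
    induction m using Nat.strong_induction_on with
    | _ m ih =>
      intro i h
      rcases Nat.eq_zero_or_pos m with rfl | hm
      · exact h
      · exact ih (m - j) (by omega) i (hserve m i h)
  -- Services keep the phase, so it is first reset by an arrival.
  have harr : P (x.1 + 1, 0) :=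
    hP x hx (.inl false) (by simp [queueMoves]) (mul_pos hlam (sub_pos.2 hq1))
  exact hempty _ _ harr

/-! ### Inflow into a state -/

theorem mul_pointInd_of_ne (c : ℝ) {y z : State} (h : z ≠ y) : c * pointInd y z = 0 := by
  rw [pointInd, if_neg h, mul_zero]

theorem hasSum_phase_succ (u : State → ℝ) (m i : ℕ) :
    HasSum (fun x : State => u x * pointInd (m, i + 1) (queueMap (.inl true) x)) (u (m, i)) := by
  have h := hasSum_single (f := fun x : State => u x * pointInd (m, i + 1)
    (queueMap (.inl true) x)) (m, i) fun x hx => mul_pointInd_of_ne _ fun h => hx ?_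
  · simpa [pointInd, queueMap] using h
  · simp only [queueMap, Prod.mk.injEq, Nat.add_right_cancel_iff] at h
    exact Prod.ext h.1 h.2

theorem hasSum_phase_zero (u : State → ℝ) (m : ℕ) :
    HasSum (fun x : State => u x * pointInd (m, 0) (queueMap (.inl true) x)) 0 := by
  simp [pointInd, queueMap, hasSum_zero]

theorem hasSum_arrival_succ (u : State → ℝ) (m i : ℕ) :
    HasSum (fun x : State => u x * pointInd (m, i + 1) (queueMap (.inl false) x)) 0 := by
  simp [pointInd, queueMap, hasSum_zero]

theorem hasSum_arrival_empty (u : State → ℝ) :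
    HasSum (fun x : State => u x * pointInd (0, 0) (queueMap (.inl false) x)) 0 := by
  simp [pointInd, queueMap, hasSum_zero]

/-- An arrival resets the phase, so the whole row `m` flows into one state. -/
theorem hasSum_arrival_zero {u : State → ℝ} {m : ℕ} {a : ℝ} (h : HasSum (fun i => u (m, i)) a) :
    HasSum (fun x : State => u x * pointInd (m + 1, 0) (queueMap (.inl false) x)) a := by
  have hinj : Function.Injective fun i : ℕ => ((m, i) : State) := Prod.mk_right_injective m
  refine (hinj.hasSum_iff fun x hx => ?_).1 (h.congr_fun fun i => ?_)
  · refine mul_pointInd_of_ne _ fun h' => hx ⟨x.2, Prod.ext ?_ rfl⟩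
    simp only [queueMap, Prod.mk.injEq, Nat.add_right_cancel_iff] at h'
    exact h'.1.symm
  · simp [pointInd, queueMap]

theorem hasSum_service_pos (u : State → ℝ) (m i j : ℕ) :
    HasSum (fun x : State => u x * pointInd (m + 1, i) (queueMap (.inr j) x))
      (u (m + 1 + j, i)) := by
  have h := hasSum_single (f := fun x : State => u x * pointInd (m + 1, i)
    (queueMap (.inr j) x)) (m + 1 + j, i) fun x hx => mul_pointInd_of_ne _ fun h => hx ?_
  · simpa [pointInd, queueMap] using h
  · simp only [queueMap, Prod.mk.injEq] at h
    exact Prod.ext (by have := h.1; simp only; omega) h.2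

/-- Truncation sends all levels `0, …, j` to the empty level; the term `u (0, i)` is a self-loop. -/
theorem hasSum_service_zero (u : State → ℝ) (i j : ℕ) :
    HasSum (fun x : State => u x * pointInd (0, i) (queueMap (.inr j) x))
      (u (0, i) + ∑ k ∈ Finset.range j, u (k + 1, i)) := by
  have hinj : Function.Injective fun k : ℕ => ((k, i) : State) := Prod.mk_left_injective i
  rw [add_comm, ← Finset.sum_range_succ' (fun k => u (k, i))]
  have h := hasSum_sum_of_ne_finset_zero (L := .unconditional State)
    (f := fun x : State => u x * pointInd (0, i) (queueMap (.inr j) x))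
    (s := (Finset.range (j + 1)).map ⟨_, hinj⟩)
    fun x hx => mul_pointInd_of_ne _ fun h => hx ?_
  · rw [Finset.sum_map] at h
    convert h using 1
    refine Finset.sum_congr rfl fun k hk => ?_
    have : k - j = 0 := by have := Finset.mem_range.1 hk; omega
    simp [pointInd, queueMap, this]
  · simp only [queueMap, Prod.mk.injEq] at h
    exact Finset.mem_map.2 ⟨x.1, Finset.mem_range.2 (by omega), Prod.ext rfl h.2.symm⟩

/-- The balance equation at `y`, with the inflows by the single moves given. -/
theorem queue_pairing_eq_zero {u : State → ℝ} (hu : Summable u)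
    (hp1 : ∑ j ∈ Finset.Icc 1 b, p j = 1) (y : State) {c d : ℝ} {e : ℕ → ℝ}
    (hc : HasSum (fun x => u x * pointInd y (queueMap (.inl true) x)) c)
    (hd : HasSum (fun x => u x * pointInd y (queueMap (.inl false) x)) d)
    (he : ∀ j, HasSum (fun x => u x * pointInd y (queueMap (.inr j) x)) (e j))
    (h : lam * q * c + lam * (1 - q) * d + mu * ∑ j ∈ Finset.Icc 1 b, p j * e j
      = (lam + mu) * u y) :
    jumpPairing (queueMoves b) (queueRate lam mu q p) queueMap u (pointInd y) = 0 := by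
  have h1 := hasSum_mul_moves (queueMoves b) (queueRate lam mu q p) queueMap hu y
  have h2 := ((hc.mul_left (lam * q)).add (hd.mul_left (lam * (1 - q)))).add
    (hasSum_sum (s := Finset.Icc 1 b) fun j _ => (he j).mul_left (mu * p j))
  have h3 := h1.unique (h2.congr_fun fun x => by
    rw [sum_queueMoves, mul_add, mul_add, Finset.mul_sum]
    simp only [queueRate, mul_left_comm])
  have h4 : ∑ j ∈ Finset.Icc 1 b, mu * p j * e j = mu * ∑ j ∈ Finset.Icc 1 b, p j * e j := by
    rw [Finset.mul_sum]; exact Finset.sum_congr rfl fun _ _ => by ring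
  -- The outflow rate includes `mu` even when the system is empty: the self-loops there appear on
  -- both sides.
  have h5 : ∑ k ∈ queueMoves b, queueRate lam mu q p k = lam + mu := by
    rw [sum_queueMoves]
    simp only [queueRate, ← Finset.mul_sum, hp1]
    ring
  rw [h4, h, h5] at h3
  linarith

end Queue

/-! ### The stationary distribution -/

/-- The product form distribution with parameters `γ` and `α`. -/
def productForm (q γ α : ℝ) : State → ℝ
  | (0, i) => (1 - q) * (q ^ i - α * (q * α) ^ i)
  | (m + 1, i) => (1 - α) * γ ^ (m + 1) * (q * α) ^ i

section ProductForm

variable {lam mu q : ℝ} {b : ℕ} {p : ℕ → ℝ} {γ α : ℝ}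

/-- The level is geometric because `hrel` gives `(1 - γ) (1 - q α) = 1 - α`. This serves both the
normalization and the arrival inflow. -/
theorem hasSum_productForm_row (hq0 : 0 < q) (hq1 : q < 1) (hα0 : 0 < α) (hα1 : α < 1)
    (hrel : α * (1 - q + q * γ) = γ) (m : ℕ) :
    HasSum (fun i => productForm q γ α (m, i)) ((1 - γ) * γ ^ m) := by
  have hqα : q * α < 1 := by nlinarith
  have hg := hasSum_geometric_of_lt_one (mul_pos hq0 hα0).le hqα
  have hne : 1 - q * α ≠ 0 := by linarith
  have hne' : 1 - q ≠ 0 := by linarith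
  cases m with
  | zero =>
    have h := ((hasSum_geometric_of_lt_one hq0.le hq1).sub (hg.mul_left α)).mul_left (1 - q)
    refine (?_ : _ = (1 - γ) * γ ^ 0) ▸ h
    field_simp
    linear_combination -hrel
  | succ m =>
    refine (?_ : _ = (1 - γ) * γ ^ (m + 1)) ▸ hg.mul_left ((1 - α) * γ ^ (m + 1))
    rw [← div_eq_mul_inv, div_eq_iff hne]
    linear_combination -γ ^ (m + 1) * hrel

theorem productForm_nonneg (hq0 : 0 < q) (hq1 : q < 1) (hα0 : 0 < α) (hα1 : α < 1)
    (hγ0 : 0 < γ) : ∀ x, 0 ≤ productForm q γ α x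
  | (0, i) => by
    have h : α ^ (i + 1) ≤ 1 := pow_le_one₀ hα0.le hα1.le
    have h' : productForm q γ α (0, i) = (1 - q) * (q ^ i * (1 - α ^ (i + 1))) := by
      simp only [productForm]; ring
    rw [h']
    exact mul_nonneg (by linarith) (mul_nonneg (pow_nonneg hq0.le i) (by linarith))
  | (m + 1, i) => by
    have : 0 ≤ 1 - α := by linarith
    simp only [productForm]
    positivity

theorem hasSum_productForm (hq0 : 0 < q) (hq1 : q < 1) (hα0 : 0 < α) (hα1 : α < 1)
    (hγ0 : 0 < γ) (hγ1 : γ < 1) (hrel : α * (1 - q + q * γ) = γ) :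
    HasSum (productForm q γ α) 1 := by
  have hrow := hasSum_productForm_row hq0 hq1 hα0 hα1 hrel
  have htot : HasSum (fun m : ℕ => (1 - γ) * γ ^ m) 1 := by
    have := (hasSum_geometric_of_lt_one hγ0.le hγ1).mul_left (1 - γ)
    rwa [mul_inv_cancel₀ (sub_pos.2 hγ1).ne'] at this
  have hs : Summable (productForm q γ α) := by
    refine (summable_prod_of_nonneg (productForm_nonneg hq0 hq1 hα0 hα1 hγ0)).2
      ⟨fun m => (hrow m).summable, ?_⟩
    simpa only [fun m => (hrow m).tsum_eq] using htot.summable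
  have := hs.hasSum.prod_fiberwise hrow
  exact (this.unique htot) ▸ hs.hasSum

/-- At level zero balance reduces to `hflow`; at positive level and phase, to the `α` equation; at
positive level and phase zero, to the latter with `hrel`. -/
theorem productForm_balance (hq0 : 0 < q) (hq1 : q < 1)
    (hp1 : ∑ j ∈ Finset.Icc 1 b, p j = 1) (hα0 : 0 < α) (hα1 : α < 1)
    (hγ0 : 0 < γ) (hγ1 : γ < 1) (hrel : α * (1 - q + q * γ) = γ)
    (hflow : mu * (γ * pgfQuot b p γ) = lam * (1 - q)) :
    ∀ y, jumpPairing (queueMoves b) (queueRate lam mu q p) queueMap (productForm q γ α)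
      (pointInd y) = 0 := by
  have hu := (hasSum_productForm hq0 hq1 hα0 hα1 hγ0 hγ1 hrel).summable
  have hrow := hasSum_productForm_row hq0 hq1 hα0 hα1 hrel
  have hS := one_sub_mul_pgfQuot hp1 γ
  have hα : α * (lam + mu - mu * pgf b p γ) = lam := by
    have hE : 0 < 1 - q + q * γ := by nlinarith
    refine mul_right_cancel₀ hE.ne' ?_
    linear_combination (lam + mu - mu * pgf b p γ) * hrel - mu * γ * hS + (1 - γ) * hflow
  have hpos : ∀ m i, ∑ j ∈ Finset.Icc 1 b, p j * productForm q γ α (m + 1 + j, i)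
      = pgf b p γ * productForm q γ α (m + 1, i) := by
    intro m i
    rw [pgf, Finset.sum_mul]
    refine Finset.sum_congr rfl fun j _ => ?_
    rw [add_right_comm]
    simp only [productForm]
    ring
  have hzero : ∀ i, ∑ j ∈ Finset.Icc 1 b, p j *
      (productForm q γ α (0, i) + ∑ k ∈ Finset.range j, productForm q γ α (k + 1, i))
      = productForm q γ α (0, i) + (1 - α) * γ * (q * α) ^ i * pgfQuot b p γ := by
    intro i
    simp only [mul_add, Finset.sum_add_distrib, ← Finset.sum_mul, hp1, one_mul]
    rw [pgfQuot, Finset.mul_sum]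
    congr 1
    refine Finset.sum_congr rfl fun j _ => ?_
    rw [mul_left_comm]
    congr 1
    rw [Finset.mul_sum]
    refine Finset.sum_congr rfl fun k _ => ?_
    simp only [productForm]
    ring
  rintro ⟨_ | m, _ | i⟩
  · refine queue_pairing_eq_zero hu hp1 _ (hasSum_phase_zero _ _) (hasSum_arrival_empty _)
      (hasSum_service_zero _ _) ?_
    rw [hzero]
    simp only [productForm]
    linear_combination (1 - α) * hflow
  · refine queue_pairing_eq_zero hu hp1 _ (hasSum_phase_succ _ _ _) (hasSum_arrival_succ _ _ _)
      (hasSum_service_zero _ _) ?_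
    rw [hzero]
    simp only [productForm]
    linear_combination (1 - α) * (q * α) ^ (i + 1) * hflow
  · refine queue_pairing_eq_zero hu hp1 _ (hasSum_phase_zero _ _) (hasSum_arrival_zero (hrow m))
      (hasSum_service_pos _ _ _) ?_
    rw [hpos]
    simp only [productForm]
    have hE : (lam + mu - mu * pgf b p γ) * γ = lam * (1 - q + q * γ) := by
      linear_combination (1 - q + q * γ) * hα - (lam + mu - mu * pgf b p γ) * hrel
    have h1 : lam * (1 - q) * (1 - γ) = (lam + mu - mu * pgf b p γ) * ((1 - α) * γ) := by
      linear_combination -hE + γ * hα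
    linear_combination γ ^ m * h1
  · refine queue_pairing_eq_zero hu hp1 _ (hasSum_phase_succ _ _ _) (hasSum_arrival_succ _ _ _)
      (hasSum_service_pos _ _ _) ?_
    rw [hpos]
    simp only [productForm]
    linear_combination -(1 - α) * γ ^ (m + 1) * q * (q * α) ^ i * hα

end ProductForm

end CoxQueue
end
open CoxQueue in
theorem mainTheorem8 (lam mu q : ℝ) (b : ℕ) (p : ℕ → ℝ)
    (hlam : 0 < lam) (hmu : 0 < mu) (hq0 : 0 < q) (hq1 : q < 1)
    (hp : ∀ j ∈ Finset.Icc 1 b, 0 ≤ p j) (hp1 : ∑ j ∈ Finset.Icc 1 b, p j = 1)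
    (herg : lam * (1 - q) < mu * CoxQueue.meanBatch b p) :
    ∃ γ α : ℝ,
      CoxQueue.IsFactorPair lam mu q b p γ α ∧
      (∀ γ' α' : ℝ, CoxQueue.IsFactorPair lam mu q b p γ' α' → γ' = γ ∧ α' = α) ∧
      ∃ π : CoxQueue.State → ℝ,
        CoxQueue.IsStationary lam mu q b p π ∧
        (∀ π' : CoxQueue.State → ℝ, CoxQueue.IsStationary lam mu q b p π' → π' = π) ∧
        (∀ m i : ℕ, 1 ≤ m →
          π (m, i) = π (0, 0) * (lam * (1 - γ) * γ ^ (m - 1) / (mu * (1 - CoxQueue.pgf b p γ)))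
            * ∏ _l ∈ Finset.Icc 1 i, (q * α)) ∧
        (∀ i : ℕ, 1 ≤ i →
          π (0, i) = π (0, 0) * q ^ i * (1 + ∑ j ∈ Finset.Icc 1 i, α ^ j)) ∧
        π (0, 0) = (1 - q) * (1 - α) := by
  obtain ⟨γ, α, hfp⟩ := exists_isFactorPair hlam hmu hq0 hq1 hp hp1 herg
  refine ⟨γ, α, hfp, fun γ' α' h => hfp.unique hlam hmu hq0 hq1 hp hp1 h, ?_⟩
  obtain ⟨hγ0, hγ1, hrel, hflow⟩ := (isFactorPair_iff hlam hmu hq0 hq1 hp hp1 γ α).1 hfp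
  have hE : 0 < 1 - q + q * γ := by nlinarith
  have hα0 : 0 < α := pos_of_mul_pos_left (hrel.symm ▸ hγ0) hE.le
  -- Otherwise `1 - q + q γ ≤ γ`, that is `(1 - q) (1 - γ) ≤ 0`.
  have hα1 : α < 1 := by
    by_contra! h
    nlinarith [mul_le_mul_of_nonneg_right h hE.le, mul_pos (sub_pos.2 hq1) (sub_pos.2 hγ1)]
  have hbal := productForm_balance hq0 hq1 hp1 hα0 hα1 hγ0 hγ1 hrel hflow
  have hsum := hasSum_productForm hq0 hq1 hα0 hα1 hγ0 hγ1 hrel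
  have h00 : productForm q γ α (0, 0) = (1 - q) * (1 - α) := by simp [productForm]
  refine ⟨productForm q γ α, ⟨productForm_nonneg hq0 hq1 hα0 hα1 hγ0, hsum, fun t _ y => ?_⟩,
    fun π' hπ' => ?_, fun m i hm => ?_, fun i _ => ?_, h00⟩
  · rw [transProb_eq_jumpTrans]
    exact hasSum_mul_jumpTrans_of_jumpPairing _ _ _ hsum.summable hbal t y
  · obtain ⟨-, hsum', hst⟩ := hπ'
    rw [transProb_eq_jumpTrans] at hst
    have hbal' := fun y => jumpPairing_eq_zero_of_stationary _ _ _ hsum'.summable y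
      fun t ht => hst t ht y
    have hdiff : HasSum (fun x => π' x + -1 * productForm q γ α x) 0 := by
      simpa using hsum'.add (hsum.mul_left (-1))
    have := eq_zero_of_jumpPairing_eq_zero _ _ _
      (queueRate_nonneg hlam hmu hq0 hq1 hp) (0, 0) (queue_reach hlam hmu hq1 hp1) hdiff
      fun y => by
        rw [jumpPairing_add_mul _ _ _ hsum'.summable hsum.summable, hbal, hbal', mul_zero, add_zero]
    funext x
    have hx := congrFun this x
    simp only [Pi.zero_apply] at hx
    linarith
  · obtain ⟨m, rfl⟩ := Nat.exists_eq_add_of_le' hm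
    have hS := one_sub_mul_pgfQuot hp1 γ
    have hpgf : 0 < 1 - pgf b p γ :=
      hS ▸ mul_pos (sub_pos.2 hγ1) (pgfQuot_pos hp hp1 hγ0.le)
    rw [h00, Finset.prod_const, Nat.card_Icc]
    simp only [productForm, Nat.add_sub_cancel]
    field_simp
    -- By `hflow` and `hS`, `λ (1 - q) (1 - γ) = μ γ (1 - φ_Y(γ))`, which trades the stated
    -- prefactor for `(1 - α) γ ^ (m + 1)`.
    linear_combination (1 - α) * γ ^ m * (mu * γ * hS * (-1) + (1 - γ) * hflow)
  · rw [h00]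
    have hgeom : 1 + ∑ j ∈ Finset.Icc 1 i, α ^ j = ∑ j ∈ Finset.range (i + 1), α ^ j := by
      rw [Finset.sum_range_succ', add_comm, pow_zero, ← Finset.Ico_add_one_right_eq_Icc,
        Finset.sum_Ico_eq_sum_range]
      simp [add_comm]
    rw [hgeom]
    have := mul_neg_geom_sum α (i + 1)
    simp only [productForm]
    linear_combination (-(1 - q) * q ^ i) * this
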